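/- Let $X$ be a Noetherian scheme and let $\mathcal F$ be a nonzero coherent $\mathcal O_X$-module satisfying Serre's condition $S_2$, i.e. $\operatorname{depth}_{\mathcal O_{X,x}}\mathcal F_x\ge\min\{2,\dim\mathcal F_x\}$ for every $x\in\operatorname{Supp}\mathcal F=\{x\in X:\mathcal F_x\neq 0\}$, where $\dim\mathcal F_x$ is the Krull dimension of the support of $\mathcal F_x$ in $\operatorname{Spec}\mathcal O_{X,x}$. Call a sheaf of modules (or a module) indecomposable if it is nonzero and is not isomorphic to a direct sum of two nonzero ones. For a topological space $T$, the codimension of an irreducible closed subset $W$ is the supremum of the lengths $n$ of chains $W=W_0\subsetneq W_1\subsetneq\dots\subsetneq W_n$ of irreducible closed subsets of $T$; the codimension $\operatorname{codim}_T Z$ of a closed subset $Z$ is the infimum of the codimensions of the irreducible closed subsets of $T$ contained in $Z$ (so $\operatorname{codim}_T\varnothing=\infty$); and $\operatorname{codim}_T(x):=\operatorname{codim}_T\overline{\{x\}}$ for $x\in T$. The space $T$ is connected in codimension $1$ if $T\setminus Z$ is connected for every closed subset $Z\subseteq T$ with $\operatorname{codim}_T Z>1$. Regard $\operatorname{Supp}\mathcal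 F$ as a topological space with the subspace topology. 1. If $\mathcal F$ is indecomposable, then $\operatorname{Supp}\mathcal F$ is connected in codimension $1$. 2. Assume in addition that for every $x\in\operatorname{Supp}\mathcal F$ with $\operatorname{codim}_{\operatorname{Supp}\mathcal F}(x)\le 1$ the stalk $\mathcal F_x$ is indecomposable as an $\mathcal O_{X,x}$-module. Then $\mathcal F$ is indecomposable if and only if $\operatorname{Supp}\mathcal F$ is connected in codimension $1$. -/

import Mathlib

open CategoryTheory CategoryTheory.Limits AlgebraicGeometry TopologicalSpace

universe u

noncomputable section

/-- The codimension of a subset `Z` of a topological space `T`: for irreducible closed `W` it is the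
supremum of the lengths of chains `W = W₀ ⊊ W₁ ⊊ ⋯ ⊊ Wₙ` of irreducible closed subsets of `T`, and
for general (closed) `Z` it is the infimum of the codimensions of the irreducible closed subsets of
`T` contained in `Z`. In particular the empty set has codimension `⊤`. -/
def topCodim {T : Type*} [TopologicalSpace T] (Z : Set T) : ℕ∞ :=
  ⨅ (W : IrreducibleCloseds T) (_ : (W : Set T) ⊆ Z), Order.coheight W

/-- A topological space `T` is connected in codimension `k` if `T ∖ Z` is connected for every closed
subset `Z` of codimension `> k`. -/
def ConnectedInCodim (k : ℕ) (T : Type*) [TopologicalSpace T] : Prop :=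
  ∀ Z : Set T, IsClosed Z → (k : ℕ∞) < topCodim Z → IsConnected Zᶜ

/-- The depth of a (nonzero, finite) module `M` over a (Noetherian) local ring `R`: the supremum of
the lengths of the `M`-regular sequences in the maximal ideal. -/
def localDepth (R : Type*) [CommRing R] [IsLocalRing R] (M : Type*) [AddCommGroup M] [Module R M] :
    ℕ∞ :=
  ⨆ (rs : List R) (_ : (∀ r ∈ rs, r ∈ IsLocalRing.maximalIdeal R) ∧
    RingTheory.Sequence.IsRegular M rs), (rs.length : ℕ∞)

namespace AlgebraicGeometry.Scheme.Modules

variable {X : Scheme.{u}}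

/-- The stalk of an `𝒪_X`-module is a module over the local ring of `X`; the scalar multiplication
is the one for which taking germs is semilinear. -/
instance stalkModuleInst (F : X.Modules) (x : X) :
    Module ↑(X.presheaf.stalk x) ↑(TopCat.Presheaf.stalk F.presheaf x) :=
  inferInstanceAs (Module ↑(TopCat.Presheaf.stalk X.presheaf x)
    ↑(TopCat.Presheaf.stalk (_root_.PresheafOfModules.presheaf
      (show _root_.PresheafOfModules.{u} (X.presheaf ⋙ forget₂ CommRingCat RingCat) from F.val)) x))

/-- The stalk `F_x` as an object of the category of `𝒪_{X,x}`-modules. -/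
def stalkModule (F : X.Modules) (x : X) : ModuleCat.{u} (X.presheaf.stalk x) :=
  ModuleCat.of ↑(X.presheaf.stalk x) ↑(TopCat.Presheaf.stalk F.presheaf x)

/-- The support of `F`: the set of points with nonzero stalk. -/
def supp (F : X.Modules) : Set X :=
  {x | Nontrivial (F.stalkModule x)}

/-- Coherent sheaves on a (locally) Noetherian scheme: `X` is covered by open affine subschemes
`Spec R` on which `F` is the sheaf associated with a finitely generated `R`-module. -/
def IsCoherentSheaf (F : X.Modules) : Prop :=
  ∀ x : X, ∃ (R : CommRingCat.{u}) (f : Spec R ⟶ X) (_ : IsOpenImmersion f) (M : ModuleCat.{u} R),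
    x ∈ Set.range f ∧ Module.Finite R M ∧ Nonempty (F.restrict f ≅ tilde M)

/-- Serre's condition `S_n` for a sheaf of modules: `depth F_x ≥ min {n, dim F_x}` for every `x` in
the support, where `dim F_x` is the dimension of the support of `F_x` in `Spec 𝒪_{X,x}`. -/
def SatisfiesSerre (n : ℕ) (F : X.Modules) : Prop :=
  ∀ x ∈ F.supp, min ((n : ℕ∞) : WithBot ℕ∞)
      (Module.supportDim (X.presheaf.stalk x) (F.stalkModule x)) ≤
    ((localDepth (X.presheaf.stalk x) (F.stalkModule x) : ℕ∞) : WithBot ℕ∞)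

end AlgebraicGeometry.Scheme.Modules

end

/-!
Both implications rest on idempotent endomorphisms `e` of `F`: in an abelian category an object is
indecomposable precisely when it is nonzero and its only idempotents are `0` and `𝟙`
(`eq_zero_or_eq_id_of_indecomposable`, `indecomposable_of_idempotent`).

Let `Z` be a closed subset of `F.supp` all of whose points have codimension at least `2`. The
codimension of a point is bounded by the dimension of the stalk (`coheight_closure_le_supportDim`), so the
condition `S₂` gives depth at least `2` along `Z` (`one_lt_localDepth`). Depth at least `1` means
that no associated prime of `F` lies in `Z`, so a section vanishing off `Z` is zero
(`section_eq_zero_of_germ_eq_zero`).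

Suppose that `F.supp ∖ Z` is disconnected. Then `F.supp` is the union of two closed sets `D₁`, `D₂`
with intersection `Z`, neither of which is `F.supp`. Every section `s` has a unique cutoff, a
section equal to `s` off `D₂` and to `0` off `D₁`. Uniqueness is the vanishing statement above, and
it reduces existence to the affine case: a finite module is the sum of its submodules of elements
supported on `D₁` and on `D₂` (`torsionBySet_sup_eq_top`); this is where depth `2` enters.
Taking cutoffs is an idempotent endomorphism other than `0` and `𝟙`
(`exists_idempotent_cutoff`), so `F` is decomposable.

Conversely, let `e` be an idempotent of `F`. The supports of `e` and of `𝟙 - e` are closed and cover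
`F.supp`. Where the stalk is indecomposable only one of them is present, so they meet in
codimension at least `2`. If the complement of the intersection is connected, one of the two
supports is contained in the intersection, and the corresponding endomorphism is zero by the
vanishing statement.
-/

/-! ### Depth and torsion over a Noetherian ring -/

section LocalConditions

variable {R : Type*} [CommRing R] {M : Type*} [AddCommGroup M] [Module R M]

/-- If `m` does not vanish in the localization of `M` at `q`, then some multiple of `m` has a prime
annihilator contained in `q`. -/
theorem exists_prime_le_eq_annihilator_smul [IsNoetherianRing R] [Module.Finite R M]
    (q : Ideal R) [q.IsPrime] (m : M) (hm : ∀ u, u ∉ q → u • m ≠ 0) :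
    ∃ (q' : Ideal R) (_ : q'.IsPrime) (c : R), q' ≤ q ∧ ∀ r, r ∈ q' ↔ r • c • m = 0 := by
  have hann : Module.annihilator R (Submodule.span R {m}) ≤ q := by
    intro r hr
    by_contra hrq
    exact hm r hrq ((Submodule.mem_annihilator_span_singleton m r).1 hr)
  obtain ⟨q', hq'min, hq'q⟩ := Ideal.exists_minimalPrimes_le hann
  obtain ⟨hp, x, hx⟩ := (isAssociatedPrime_iff).1
    (Module.associatedPrimes.minimalPrimes_annihilator_subset_associatedPrimes R
      (Submodule.span R {m}) hq'min)
  obtain ⟨c, hc⟩ := Submodule.mem_span_singleton.1 x.2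
  refine ⟨q', hp, c, hq'q, fun r => ?_⟩
  rw [hx, hc, Submodule.mem_colon_singleton, Submodule.mem_bot, ← Submodule.coe_eq_zero]
  rfl

/-- The localization of `M` at `q` has an element of `q` acting injectively on it; for finite `M`
over a Noetherian ring with `q` in the support this says that the depth of `M` at `q` is at
least `1`. Vanishing in the localization is spelled out with denominators. -/
def PosDepthAt (M : Type*) [AddCommGroup M] [Module R M] (q : Ideal R) : Prop :=
  ∃ a ∈ q, ∀ m : M, ∀ u ∉ q, u • a • m = 0 → ∃ v ∉ q, v • m = 0

/-- Elements `a, b` of `q` form a weakly regular sequence on the localization of `M` at `q`. As in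
`PosDepthAt`, equalities in the localization are spelled out with denominators. -/
def DepthTwoAt (M : Type*) [AddCommGroup M] [Module R M] (q : Ideal R) : Prop :=
  ∃ a ∈ q, ∃ b ∈ q, (∀ m : M, ∀ u ∉ q, u • a • m = 0 → ∃ v ∉ q, v • m = 0) ∧
    ∀ m m' : M, b • m = a • m' → ∃ v ∉ q, ∃ m'' : M, v • m = a • m''

theorem DepthTwoAt.posDepthAt {q : Ideal R} (h : DepthTwoAt M q) : PosDepthAt M q := by
  obtain ⟨a, ha, b, -, h1, -⟩ := h
  exact ⟨a, ha, h1⟩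

/-- An associated prime of `M` has depth `0`. -/
theorem not_posDepthAt_of_annihilator {q : Ideal R} [q.IsPrime] {m : M}
    (hm : ∀ r, r ∈ q ↔ r • m = 0) : ¬ PosDepthAt M q := by
  rintro ⟨a, ha, h⟩
  obtain ⟨v, hv, hv0⟩ := h m 1 (q.ne_top_iff_one.1 (Ideal.IsPrime.ne_top ‹_›))
    (by rw [(hm a).1 ha, smul_zero])
  exact hv ((hm v).2 hv0)

/-- If `M` has positive depth along `V(I₁) ∩ V(I₂)`, it has no nonzero element killed by both
ideals: an associated prime of such an element would lie in `V(I₁) ∩ V(I₂)`. -/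
theorem torsionBySet_inf_eq_bot [IsNoetherianRing R] (I₁ I₂ : Ideal R)
    (hdepth : ∀ q : Ideal R, q.IsPrime → I₁ ≤ q → I₂ ≤ q → PosDepthAt M q) :
    Submodule.torsionBySet R M I₁ ⊓ Submodule.torsionBySet R M I₂ = ⊥ := by
  rw [eq_bot_iff]
  intro w hw
  by_contra hw0
  obtain ⟨q, hq, hle⟩ := exists_le_isAssociatedPrime_of_isNoetherianRing R w hw0
  obtain ⟨hp, x, hx⟩ := isAssociatedPrime_iff.1 hq
  have key (I : Ideal R) (hI : w ∈ Submodule.torsionBySet R M I) : I ≤ q := fun r hr => hle (by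
    rw [Submodule.mem_colon_singleton, Submodule.mem_bot]
    exact (Submodule.mem_torsionBySet_iff _ _).1 hI ⟨r, hr⟩)
  refine not_posDepthAt_of_annihilator (m := x) (q := q) ?_ (hdepth q hp (key _ hw.1) (key _ hw.2))
  intro r
  rw [hx, Submodule.mem_colon_singleton, Submodule.mem_bot]

/-- If `I` kills `m` in the localization at `q`, then it kills a multiple of `m` by a denominator,
because `I` is finitely generated. -/
theorem exists_smul_mem_torsionBySet [IsNoetherianRing R] (I q : Ideal R) [q.IsPrime] (m : M)
    (h : ∀ r ∈ I, ∃ v ∉ q, v • r • m = 0) :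
    ∃ v ∉ q, v • m ∈ Submodule.torsionBySet R M I := by
  obtain ⟨s, hs⟩ := (isNoetherianRing_iff_ideal_fg R).1 ‹_› I
  choose! v hv hv0 using h
  refine ⟨∏ r ∈ s, v r, ?_, ?_⟩
  · intro hmem
    obtain ⟨r, hr, hrq⟩ := (Ideal.IsPrime.prod_mem_iff).1 hmem
    exact hv r (hs ▸ Ideal.subset_span hr) hrq
  · have hle : I ≤ Module.annihilator R (Submodule.span R {(∏ r ∈ s, v r) • m}) := by
      conv_lhs => rw [← hs]
      rw [Ideal.span_le]
      intro r hr
      refine (Submodule.mem_annihilator_span_singleton _ _).2 ?_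
      obtain ⟨c, hc⟩ := Finset.dvd_prod_of_mem v hr
      rw [hc, smul_smul, show r * (v r * c) = c * (v r * r) by ring, mul_smul, mul_smul,
        hv0 r (hs ▸ Ideal.subset_span hr), smul_zero]
    rw [Submodule.mem_torsionBySet_iff]
    rintro ⟨r, hr⟩
    exact (Submodule.mem_annihilator_span_singleton _ _).1 (hle hr)

/-- The splitting in the affine case. If `I₁ I₂` kills `M` and `M` has depth at least `2` along
`V(I₁) ∩ V(I₂)`, then every element of `M` is the sum of one killed by `I₁` and one killed by `I₂`.
Writing `T₁`, `T₂` for the two torsion submodules, one has an exact sequence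
`0 → M → M/T₁ × M/T₂ → M/(T₁ + T₂) → 0`; an associated prime `q` of the cokernel lies in
`V(I₁) ∩ V(I₂)`, and there the depth of `M` forbids it. -/
theorem torsionBySet_sup_eq_top [IsNoetherianRing R] (I₁ I₂ : Ideal R)
    (hI : ∀ r₁ ∈ I₁, ∀ r₂ ∈ I₂, ∀ m : M, r₁ • r₂ • m = 0)
    (hdepth : ∀ q : Ideal R, q.IsPrime → I₁ ≤ q → I₂ ≤ q → DepthTwoAt M q) :
    Submodule.torsionBySet R M I₁ ⊔ Submodule.torsionBySet R M I₂ = ⊤ := by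
  set T₁ := Submodule.torsionBySet R M I₁
  set T₂ := Submodule.torsionBySet R M I₂
  have hdisj : T₁ ⊓ T₂ = ⊥ :=
    torsionBySet_inf_eq_bot I₁ I₂ fun q hq h1 h2 => (hdepth q hq h1 h2).posDepthAt
  rw [eq_top_iff]
  intro m₀ _
  by_contra hm₀
  have hm₀' : (T₁ ⊔ T₂).mkQ m₀ ≠ 0 := by simpa using hm₀
  obtain ⟨q, hq, -⟩ := exists_le_isAssociatedPrime_of_isNoetherianRing R _ hm₀'
  obtain ⟨hp, x, hx⟩ := isAssociatedPrime_iff.1 hq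
  obtain ⟨m, rfl⟩ := (T₁ ⊔ T₂).mkQ_surjective x
  have hq_iff (r : R) : r ∈ q ↔ r • m ∈ T₁ ⊔ T₂ := by
    rw [hx, Submodule.mem_colon_singleton, Submodule.mem_bot, ← map_smul, Submodule.mkQ_apply,
      Submodule.Quotient.mk_eq_zero]
  -- `I₁ M ⊆ T₂` and `I₂ M ⊆ T₁`, so `q` contains both ideals and the depth hypothesis applies.
  have h1 : I₁ ≤ q := fun r hr => (hq_iff r).2 <| Submodule.mem_sup_right <|
    (Submodule.mem_torsionBySet_iff _ _).2 fun r' => by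
      rw [smul_comm]; exact hI r hr _ r'.2 m
  have h2 : I₂ ≤ q := fun r hr => (hq_iff r).2 <| Submodule.mem_sup_left <|
    (Submodule.mem_torsionBySet_iff _ _).2 fun r' => hI _ r'.2 r hr m
  obtain ⟨a, ha, b, hb, ha', hb'⟩ := hdepth q hp h1 h2
  obtain ⟨x₁, hx₁, x₂, hx₂, hax⟩ := Submodule.mem_sup.1 ((hq_iff a).1 ha)
  obtain ⟨y₁, hy₁, y₂, hy₂, hby⟩ := Submodule.mem_sup.1 ((hq_iff b).1 hb)
  -- The two expressions for `a b m` in `T₁ ⊕ T₂` agree componentwise.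
  have hkey : b • x₁ - a • y₁ = a • y₂ - b • x₂ := by
    have : b • (x₁ + x₂) = a • (y₁ + y₂) := by rw [hax, hby, smul_comm]
    rw [smul_add, smul_add] at this
    rw [sub_eq_sub_iff_add_eq_add, this, add_comm]
  have hzero : b • x₁ - a • y₁ = 0 := by
    have : b • x₁ - a • y₁ ∈ T₁ ⊓ T₂ :=
      ⟨T₁.sub_mem (T₁.smul_mem _ hx₁) (T₁.smul_mem _ hy₁),
        hkey ▸ T₂.sub_mem (T₂.smul_mem _ hy₂) (T₂.smul_mem _ hx₂)⟩
    rwa [hdisj, Submodule.mem_bot] at this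
  obtain ⟨u₁, hu₁, z₁, hz₁⟩ := hb' x₁ y₁ (sub_eq_zero.1 hzero)
  obtain ⟨u₂, hu₂, z₂, hz₂⟩ := hb' x₂ y₂ (sub_eq_zero.1 (hkey ▸ hzero)).symm
  -- The quotients `zᵢ = uᵢ xᵢ / a` lie in `Tᵢ` up to denominators, as `a` is regular at `q`.
  have spread (I : Ideal R) (u : R) (x z : M) (hx : x ∈ Submodule.torsionBySet R M I)
      (hz : u • x = a • z) : ∃ v ∉ q, v • z ∈ Submodule.torsionBySet R M I := by
    refine exists_smul_mem_torsionBySet I q z fun r hr => ha' _ 1 (q.ne_top_iff_one.1 hp.ne_top) ?_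
    rw [one_smul, smul_comm, ← hz, smul_comm,
      show r • x = 0 from (Submodule.mem_torsionBySet_iff _ _).1 hx ⟨r, hr⟩, smul_zero]
  obtain ⟨v₁, hv₁, hv₁z⟩ := spread I₁ u₁ x₁ z₁ hx₁ hz₁
  obtain ⟨v₂, hv₂, hv₂z⟩ := spread I₂ u₂ x₂ z₂ hx₂ hz₂
  -- `a` kills `u₁ u₂ m - u₂ z₁ - u₁ z₂`, which therefore vanishes at `q`. So a multiple of `m` by
  -- an element outside `q` lies in `T₁ + T₂`, contradicting the choice of `q`.
  obtain ⟨w, hw, hw0⟩ := ha' ((u₁ * u₂) • m - u₂ • z₁ - u₁ • z₂) 1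
    (q.ne_top_iff_one.1 hp.ne_top) (by
      rw [one_smul, smul_sub, smul_sub, smul_comm a u₂ z₁, smul_comm a u₁ z₂, ← hz₁, ← hz₂,
        smul_comm a (u₁ * u₂) m, ← hax]
      module)
  have hmem : (w * (u₁ * u₂) * (v₁ * v₂)) • m ∈ T₁ ⊔ T₂ := by
    have : (w * (u₁ * u₂) * (v₁ * v₂)) • m =
        (w * u₂ * v₂) • v₁ • z₁ + (w * u₁ * v₁) • v₂ • z₂ := by
      have h := congr_arg (fun t => (v₁ * v₂) • t) hw0
      simp only [smul_zero] at h
      rw [← sub_eq_zero, ← h]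
      module
    rw [this]
    exact Submodule.add_mem_sup (T₁.smul_mem _ hv₁z) (T₂.smul_mem _ hv₂z)
  have := (hq_iff _).2 hmem
  simp only [hp.mul_mem_iff_mem_or_mem] at this
  tauto

/-- A cover of the support of `M` by two closed sets is cut out by two ideals whose product kills
`M`: suitable powers of any ideals defining the closed sets. -/
theorem exists_ideals_of_support_subset [IsNoetherianRing R] [Module.Finite R M]
    {C₁ C₂ : Set (PrimeSpectrum R)} (h₁ : IsClosed C₁) (h₂ : IsClosed C₂)
    (h : Module.support R M ⊆ C₁ ∪ C₂) :
    ∃ I₁ I₂ : Ideal R, PrimeSpectrum.zeroLocus (I₁ : Set R) = C₁ ∧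
      PrimeSpectrum.zeroLocus (I₂ : Set R) = C₂ ∧
      ∀ r₁ ∈ I₁, ∀ r₂ ∈ I₂, ∀ m : M, r₁ • r₂ • m = 0 := by
  obtain ⟨J₁, rfl⟩ := (PrimeSpectrum.isClosed_iff_zeroLocus_ideal _).1 h₁
  obtain ⟨J₂, rfl⟩ := (PrimeSpectrum.isClosed_iff_zeroLocus_ideal _).1 h₂
  have hrad : J₁ * J₂ ≤ (Module.annihilator R M).radical := by
    rw [← PrimeSpectrum.zeroLocus_subset_zeroLocus_iff, PrimeSpectrum.zeroLocus_mul,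
      ← Module.support_eq_zeroLocus]
    exact h
  obtain ⟨n, hn⟩ := Ideal.exists_pow_le_of_le_radical_of_fg hrad
    ((isNoetherianRing_iff_ideal_fg R).1 ‹_› _)
  -- The exponent `n + 1` rather than `n` keeps the zero loci unchanged when `n = 0`.
  refine ⟨J₁ ^ (n + 1), J₂ ^ (n + 1), PrimeSpectrum.zeroLocus_pow _ n.succ_ne_zero,
    PrimeSpectrum.zeroLocus_pow _ n.succ_ne_zero, fun r₁ h₁ r₂ h₂ m => ?_⟩
  rw [smul_smul]
  refine Module.mem_annihilator.1 (hn (Ideal.pow_le_pow_right n.le_succ ?_)) m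
  rw [mul_pow]
  exact Ideal.mul_mem_mul h₁ h₂

theorem exists_of_one_lt_localDepth [IsLocalRing R] (h : 1 < localDepth R M) :
    ∃ x ∈ IsLocalRing.maximalIdeal R, ∃ y ∈ IsLocalRing.maximalIdeal R,
      (∀ v : M, x • v = 0 → v = 0) ∧ ∀ v w : M, y • v = x • w → ∃ w' : M, v = x • w' := by
  obtain ⟨rs, hrs⟩ := lt_iSup_iff.1 h
  obtain ⟨⟨hmem, hreg⟩, hlen⟩ := lt_iSup_iff.1 hrs
  match rs, hmem, hreg, hlen with
  | [], _, _, hlen => simp at hlen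
  | [_], _, _, hlen => simp at hlen
  | x :: y :: _, hmem, hreg, _ =>
    obtain ⟨hx, hreg⟩ := (RingTheory.Sequence.isRegular_cons_iff _ _ _).1 hreg
    obtain ⟨hy, -⟩ := (RingTheory.Sequence.isRegular_cons_iff _ _ _).1 hreg
    refine ⟨x, hmem x (by simp), y, hmem y (by simp),
      isSMulRegular_iff_right_eq_zero_of_smul.1 hx, fun v w hv => ?_⟩
    have h1 := isSMulRegular_iff_right_eq_zero_of_smul.1 hy (Submodule.Quotient.mk v) (by
      rw [← Submodule.Quotient.mk_smul, Submodule.Quotient.mk_eq_zero]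
      exact (Submodule.mem_smul_pointwise_iff_exists _ _ _).2 ⟨w, trivial, hv.symm⟩)
    rw [Submodule.Quotient.mk_eq_zero] at h1
    obtain ⟨w', -, hw'⟩ := (Submodule.mem_smul_pointwise_iff_exists _ _ _).1 h1
    exact ⟨w', hw'.symm⟩

end LocalConditions

/-! ### Germs, stalks and affine charts of sheaves of modules -/

namespace AlgebraicGeometry.Scheme.Modules

variable {X : Scheme.{u}}

/-- The stalk of a sheaf of modules, as a type. -/
abbrev Stalk (F : X.Modules) (x : X) : Type u := ↑(TopCat.Presheaf.stalk F.presheaf x)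

/-- The germ at `x` of a section over an open neighbourhood of `x`. -/
noncomputable def germ (F : X.Modules) {U : X.Opens} (x : X) (hx : x ∈ U) : Γ(F, U) →+ Stalk F x :=
  (TopCat.Presheaf.germ F.presheaf U x hx).hom

theorem germ_smul (F : X.Modules) {U : X.Opens} (x : X) (hx : x ∈ U) (r : Γ(X, U)) (s : Γ(F, U)) :
    F.germ x hx (r • s) = X.presheaf.germ U x hx r • F.germ x hx s :=
  PresheafOfModules.germ_smul (X := X.toTopCat) (R := X.presheaf) F.val x U hx r s

theorem germ_res (F : X.Modules) {U V : X.Opens} (i : V ⟶ U) (x : X) (hx : x ∈ V) (s : Γ(F, U)) :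
    F.germ x hx (F.presheaf.map i.op s) = F.germ x (i.le hx) s :=
  TopCat.Presheaf.germ_res_apply F.presheaf i x hx s

theorem exists_germ_eq (F : X.Modules) (x : X) (v : Stalk F x) :
    ∃ (U : X.Opens) (hx : x ∈ U) (s : Γ(F, U)), F.germ x hx s = v :=
  TopCat.Presheaf.exists_germ_eq F.presheaf v

theorem exists_res_eq_of_germ_eq (F : X.Modules) {U V : X.Opens} (x : X) (hU : x ∈ U) (hV : x ∈ V)
    (s : Γ(F, U)) (t : Γ(F, V)) (h : F.germ x hU s = F.germ x hV t) :
    ∃ (W : X.Opens) (_ : x ∈ W) (iU : W ⟶ U) (iV : W ⟶ V),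
      F.presheaf.map iU.op s = F.presheaf.map iV.op t :=
  TopCat.Presheaf.germ_eq F.presheaf x hU hV s t h

/-- A relation `a s = t` between germs at `x` persists in a neighbourhood of `x`. -/
theorem exists_nhds_germ_smul_eq (F : X.Modules) {U V W : X.Opens} {t : Γ(F, W)} (x : X)
    (hU : x ∈ U) (hV : x ∈ V) (hW : x ∈ W) (a : Γ(X, U)) (s : Γ(F, V))
    (h : X.presheaf.germ U x hU a • F.germ x hV s = F.germ x hW t) :
    ∃ N : X.Opens, x ∈ N ∧ ∀ y ∈ N, ∀ (hU : y ∈ U) (hV : y ∈ V) (hW : y ∈ W),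
      X.presheaf.germ U y hU a • F.germ y hV s = F.germ y hW t := by
  let i₁ : U ⊓ V ⟶ U := homOfLE inf_le_left
  let i₂ : U ⊓ V ⟶ V := homOfLE inf_le_right
  have key (y : X) (hU : y ∈ U) (hV : y ∈ V) :
      F.germ y (show y ∈ U ⊓ V from ⟨hU, hV⟩) (X.presheaf.map i₁.op a • F.presheaf.map i₂.op s) =
        X.presheaf.germ U y hU a • F.germ y hV s := by
    rw [germ_smul, germ_res]
    congr 1
    exact TopCat.Presheaf.germ_res_apply X.presheaf i₁ _ _ a
  obtain ⟨N, hN, i, j, hij⟩ := F.exists_res_eq_of_germ_eq x _ hW _ _ ((key x hU hV).trans h)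
  refine ⟨N, hN, fun y hy hU hV hW => ?_⟩
  rw [← key y hU hV, ← F.germ_res i y hy, hij, germ_res]

theorem section_ext (F : X.Modules) {U : X.Opens} (s t : Γ(F, U))
    (h : ∀ x (hx : x ∈ U), F.germ x hx s = F.germ x hx t) : s = t :=
  TopCat.Presheaf.section_ext ⟨F.presheaf, F.isSheaf⟩ U s t h

theorem mem_supp (F : X.Modules) (x : X) : x ∈ F.supp ↔ Nontrivial (Stalk F x) := Iff.rfl

/-- The map on stalks induced by a morphism of sheaves of modules, as a linear map over the local
ring. -/
noncomputable def stalkMap {F G : X.Modules} (φ : F ⟶ G) (x : X) :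
    Stalk F x →ₗ[X.presheaf.stalk x] Stalk G x where
  toFun := ((TopCat.Presheaf.stalkFunctor Ab.{u} x).map φ.mapPresheaf).hom
  map_add' := map_add _
  map_smul' r v := by
    obtain ⟨U, hU, s, rfl⟩ := F.exists_germ_eq x v
    obtain ⟨V, hV, a, rfl⟩ := X.presheaf.exists_germ_eq r
    have hW : x ∈ U ⊓ V := ⟨hU, hV⟩
    rw [← F.germ_res (homOfLE inf_le_left) x hW,
      ← X.presheaf.germ_res_apply (homOfLE inf_le_right) x hW a]
    generalize (X.presheaf.map (homOfLE (inf_le_right : U ⊓ V ≤ V)).op) a = a'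
    generalize F.presheaf.map (homOfLE (inf_le_left : U ⊓ V ≤ U)).op s = s'
    have key (t : Γ(F, U ⊓ V)) : ((TopCat.Presheaf.stalkFunctor Ab.{u} x).map φ.mapPresheaf).hom
        (F.germ x hW t) = G.germ x hW (φ.app _ t) :=
      TopCat.Presheaf.stalkFunctor_map_germ_apply _ x hW φ.mapPresheaf t
    refine (congr_arg _ (F.germ_smul x hW a' s').symm).trans ((key _).trans ?_)
    rw [Hom.app_smul, germ_smul]
    exact congr_arg _ (key s').symm

theorem stalkMap_germ {F G : X.Modules} (φ : F ⟶ G) {U : X.Opens} (x : X) (hx : x ∈ U)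
    (s : Γ(F, U)) : stalkMap φ x (F.germ x hx s) = G.germ x hx (φ.app U s) :=
  TopCat.Presheaf.stalkFunctor_map_germ_apply U x hx φ.mapPresheaf s

end AlgebraicGeometry.Scheme.Modules

namespace AlgebraicGeometry

open Scheme.Modules

section Tilde

variable {R : CommRingCat.{u}} (M : ModuleCat.{u} R)

/-- The global section of `M^~` defined by an element of `M`. -/
noncomputable def tilde.globalSection : M →+ Γ(tilde M, ⊤) := (tilde.toOpen M ⊤).hom.toAddMonoidHom

theorem tilde.globalSection_smul (r : R) (m : M) :
    tilde.globalSection M (r • m) = (Scheme.ΓSpecIso R).inv r • tilde.globalSection M m :=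
  (tilde.toOpen M ⊤).hom.map_smul r m

theorem tilde.germ_globalSection_eq_zero_iff (p : Spec R) (m : M) :
    (tilde M).germ (U := ⊤) p trivial (tilde.globalSection M m) = 0 ↔
      ∃ s ∉ p.asIdeal, s • m = 0 := by
  have h (x : PrimeSpectrum.Top R) : tilde.toStalk M x m = 0 ↔ ∃ s ∉ x.asIdeal, s • m = 0 := by
    have := PrimeSpectrum.isPrime x
    refine (IsLocalizedModule.eq_zero_iff x.asIdeal.primeCompl (tilde.toStalk M x).hom).trans ?_
    exact ⟨fun ⟨s, h⟩ => ⟨s, s.2, h⟩, fun ⟨s, hs, h⟩ => ⟨⟨s, hs⟩, h⟩⟩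
  exact h p

theorem tilde.exists_smul_eq_germ_globalSection (p : Spec R)
    (v : Stalk (tilde M) p) :
    ∃ s ∉ p.asIdeal, ∃ m : M,
      ((Spec R).presheaf.germ ⊤ p trivial ((Scheme.ΓSpecIso R).inv s)) • v =
        (tilde M).germ (U := ⊤) p trivial (tilde.globalSection M m) := by
  have h (x : PrimeSpectrum.Top R) (w : (tilde M).presheaf.stalk x) :
      ∃ s ∉ x.asIdeal, ∃ m : M,  s • w = tilde.toStalk M x m := by
    have := PrimeSpectrum.isPrime x
    obtain ⟨⟨m, s⟩, h⟩ := IsLocalizedModule.surj x.asIdeal.primeCompl (tilde.toStalk M x).hom w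
    exact ⟨s, s.2, m, h⟩
  obtain ⟨s, hs, m, h⟩ := h p v
  exact ⟨s, hs, m, h⟩

theorem Spec.isUnit_germ_iff (p : Spec R) (r : R) :
    IsUnit ((Spec R).presheaf.germ ⊤ p trivial ((Scheme.ΓSpecIso R).inv r)) ↔ r ∉ p.asIdeal :=
  have h (x : PrimeSpectrum R) : IsUnit (StructureSheaf.toStalk R x r) ↔ r ∉ x.asIdeal :=
    IsLocalization.AtPrime.isUnit_to_map_iff
      ((AlgebraicGeometry.Spec.structureSheaf R).presheaf.stalk x) x.asIdeal r
  h p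

theorem Spec.exists_germ_mul_eq (p : Spec R)
    (z : (Spec R).presheaf.stalk (p : Spec R)) :
    ∃ s ∉ p.asIdeal, ∃ r : R,
      (Spec R).presheaf.germ ⊤ p trivial ((Scheme.ΓSpecIso R).inv s) * z =
        (Spec R).presheaf.germ ⊤ p trivial ((Scheme.ΓSpecIso R).inv r) := by
  have h (x : PrimeSpectrum R) (w : (AlgebraicGeometry.Spec.structureSheaf R).presheaf.stalk x) :
      ∃ s ∉ x.asIdeal, ∃ r : R,
        algebraMap R ((AlgebraicGeometry.Spec.structureSheaf R).presheaf.stalk x) s * w =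
          algebraMap R _ r := by
    obtain ⟨⟨r, s⟩, h⟩ := IsLocalization.surj x.asIdeal.primeCompl w
    exact ⟨s, s.2, r, (mul_comm _ _).trans h⟩
  exact h p z

end Tilde

namespace Scheme.Modules

variable {X : Scheme.{u}}

/-- An affine chart of `F`: an open immersion from an affine scheme along which `F` restricts to the
sheaf associated with a finite module. The stalks of `F` at points of the chart are described below
in terms of elements of `M`, so that no localized module has to be chosen. -/
structure AffineChart (F : X.Modules) where
  /-- the coordinate ring of the chart -/
  R : CommRingCat.{u}
  /-- the inclusion of the chart -/
  f : Spec R ⟶ X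
  isOpenImmersion : IsOpenImmersion f
  /-- the module of sections of `F` on the chart -/
  M : ModuleCat.{u} R
  finite : Module.Finite R M
  /-- the identification of `F` on the chart with the sheaf associated with `M` -/
  iso : F.restrict f ≅ tilde M

namespace AffineChart

variable {F : X.Modules} (c : AffineChart F)

instance : IsOpenImmersion c.f := c.isOpenImmersion
instance : Module.Finite c.R c.M := c.finite

/-- The open image of the chart. -/
noncomputable def W : X.Opens := c.f ''ᵁ ⊤

/-- The point of `X` given by a prime of the coordinate ring. -/
noncomputable def pt (p : Spec c.R) : X := c.f p

theorem pt_mem (p : Spec c.R) : c.pt p ∈ c.W := ⟨p, trivial, rfl⟩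

theorem exists_pt_eq {x : X} (hx : x ∈ c.W) : ∃ p, c.pt p = x := by
  obtain ⟨p, -, hp⟩ := hx
  exact ⟨p, hp⟩

theorem pt_mem_image {p : Spec c.R} {U : (Spec c.R).Opens} (hp : p ∈ U) : c.pt p ∈ c.f ''ᵁ U :=
  ⟨p, hp, rfl⟩

theorem continuous_pt : Continuous c.pt := c.f.continuous

/-- Elements of the coordinate ring as functions on the chart. -/
noncomputable def res : c.R →+* Γ(X, c.W) := ((Scheme.ΓSpecIso c.R).inv ≫ (c.f.appIso ⊤).inv).hom

/-- Elements of the module as sections of `F` on the chart. -/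
noncomputable def sec : c.M →+ Γ(F, c.W) := ((F.restrictAppIso c.f ⊤).hom.hom).comp
    ((c.iso.inv.app ⊤).hom.comp (tilde.globalSection c.M))

theorem sec_smul (r : c.R) (m : c.M) : c.sec (r • m) = c.res r • c.sec m := by
  change (c.iso.inv.app ⊤) (tilde.globalSection c.M (r • m)) = _
  rw [tilde.globalSection_smul, Hom.app_smul]
  rfl

/-- The map from the coordinate ring to the local ring at a point of the chart. -/
noncomputable def ringGerm (p : Spec c.R) : c.R →+* X.presheaf.stalk (c.pt p) :=
  (X.presheaf.germ c.W (c.pt p) (c.pt_mem p)).hom.comp c.res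

/-- The map from the module of the chart to the stalk of `F`. -/
noncomputable def secGerm (p : Spec c.R) : c.M →+ Stalk F (c.pt p) :=
  (F.germ (c.pt p) (c.pt_mem p)).comp c.sec

theorem secGerm_smul (p : Spec c.R) (r : c.R) (m : c.M) :
    c.secGerm p (r • m) = c.ringGerm p r • c.secGerm p m := by
  change F.germ _ _ (c.sec (r • m)) = _
  rw [sec_smul, germ_smul]
  rfl

/-- The stalk of `F` at a point of the chart is the stalk of the sheaf associated with `M`. -/
noncomputable def stalkEquiv (p : Spec c.R) : Stalk (tilde c.M) p ≃+ Stalk F (c.pt p) :=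
  (((toPresheaf _ ⋙ TopCat.Presheaf.stalkFunctor Ab.{u} p).mapIso c.iso.symm) ≪≫
    (restrictStalkNatIso c.f p).app F).addCommGroupIsoToAddEquiv

theorem stalkEquiv_germ (p : Spec c.R) (U : (Spec c.R).Opens) (hp : (p : Spec c.R) ∈ U)
    (t : Γ(tilde c.M, U)) : c.stalkEquiv p ((tilde c.M).germ _ hp t) =
      F.germ (U := c.f ''ᵁ U) (c.pt p) (c.pt_mem_image hp) (c.iso.inv.app U t) := by
  have h1 := TopCat.Presheaf.stalkFunctor_map_germ_apply U (p : Spec c.R) hp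
    c.iso.inv.mapPresheaf t
  have h2 := congr($(germ_restrictStalkNatIso_hom_app c.f (p : Spec c.R) F hp) (c.iso.inv.app U t))
  exact (congr_arg ((restrictStalkNatIso c.f (p : Spec c.R)).hom.app F) h1).trans h2

theorem stalkEquiv_globalSection (p : Spec c.R) (m : c.M) :
    c.stalkEquiv p ((tilde c.M).germ (U := ⊤) p trivial (tilde.globalSection c.M m)) =
      c.secGerm p m :=
  c.stalkEquiv_germ p ⊤ trivial _

theorem secGerm_eq_zero_iff (p : Spec c.R) (m : c.M) :
    c.secGerm p m = 0 ↔ ∃ s ∉ p.asIdeal, s • m = 0 := by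
  rw [← stalkEquiv_globalSection, EmbeddingLike.map_eq_zero_iff,
    tilde.germ_globalSection_eq_zero_iff]

/-- The local ring of `X` at a point of the chart is that of the affine scheme. -/
noncomputable def stalkRingEquiv (p : Spec c.R) :
    (Spec c.R).presheaf.stalk p ≃+* X.presheaf.stalk (c.pt p) :=
  (asIso (c.f.stalkMap p)).symm.commRingCatIsoToRingEquiv

theorem stalkRingEquiv_germ (p : Spec c.R) (U : (Spec c.R).Opens) (hp : p ∈ U)
    (a : Γ(Spec c.R, U)) :
    c.stalkRingEquiv p ((Spec c.R).presheaf.germ U p hp a) =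
      X.presheaf.germ (c.f ''ᵁ U) (c.pt p) (c.pt_mem_image hp) ((c.f.appIso U).inv a) := by
  apply (c.stalkRingEquiv p).symm.injective
  rw [RingEquiv.symm_apply_apply]
  refine Eq.trans ?_ (c.f.germ_stalkMap_apply (c.f ''ᵁ U) p (c.pt_mem_image hp) _).symm
  have h := congr($(c.f.appIso_inv_app U) a)
  have h' : c.f.app (c.f ''ᵁ U) ((c.f.appIso U).inv a) =
      (Spec c.R).presheaf.map (eqToHom (c.f.preimage_image_eq U)).op a := h
  rw [h']
  exact (TopCat.Presheaf.germ_res_apply (Spec c.R).presheaf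
    (eqToHom (c.f.preimage_image_eq U)) p _ a).symm

theorem stalkEquiv_smul (p : Spec c.R) (z : (Spec c.R).presheaf.stalk p)
    (v : Stalk (tilde c.M) p) :
    c.stalkEquiv p (z • v) = c.stalkRingEquiv p z • c.stalkEquiv p v := by
  obtain ⟨U, hU, s, rfl⟩ := (tilde c.M).exists_germ_eq p v
  obtain ⟨V, hV, a, rfl⟩ := (Spec c.R).presheaf.exists_germ_eq z
  have hW : p ∈ U ⊓ V := ⟨hU, hV⟩
  rw [← (tilde c.M).germ_res (homOfLE inf_le_left) p hW,
    ← (Spec c.R).presheaf.germ_res_apply (homOfLE inf_le_right) p hW a, ← germ_smul,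
    stalkEquiv_germ, Hom.app_smul, stalkEquiv_germ, stalkRingEquiv_germ]
  exact F.germ_smul (c.pt p) (c.pt_mem_image hW) _ _

theorem stalkRingEquiv_globalSection (p : Spec c.R) (r : c.R) :
    c.stalkRingEquiv p ((Spec c.R).presheaf.germ ⊤ p trivial ((Scheme.ΓSpecIso c.R).inv r)) =
      c.ringGerm p r :=
  c.stalkRingEquiv_germ p ⊤ trivial _

theorem exists_smul_eq_secGerm (p : Spec c.R) (v : Stalk F (c.pt p)) :
    ∃ s ∉ p.asIdeal, ∃ m : c.M, c.ringGerm p s • v = c.secGerm p m := by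
  obtain ⟨v, rfl⟩ := (c.stalkEquiv p).surjective v
  obtain ⟨s, hs, m, h⟩ := tilde.exists_smul_eq_germ_globalSection c.M p v
  refine ⟨s, hs, m, ?_⟩
  rw [← stalkEquiv_globalSection, ← h, stalkEquiv_smul, stalkRingEquiv_globalSection]

theorem isUnit_ringGerm_iff (p : Spec c.R) (r : c.R) :
    IsUnit (c.ringGerm p r) ↔ r ∉ p.asIdeal := by
  rw [← stalkRingEquiv_globalSection, ← Spec.isUnit_germ_iff]
  exact MulEquiv.isUnit_map (c.stalkRingEquiv p)

theorem exists_mul_eq_ringGerm (p : Spec c.R) (z : X.presheaf.stalk (c.pt p)) :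
    ∃ s ∉ p.asIdeal, ∃ r : c.R, c.ringGerm p s * z = c.ringGerm p r := by
  obtain ⟨z, rfl⟩ := (c.stalkRingEquiv p).surjective z
  obtain ⟨s, hs, r, h⟩ := Spec.exists_germ_mul_eq p z
  refine ⟨s, hs, r, ?_⟩
  rw [← stalkRingEquiv_globalSection, ← stalkRingEquiv_globalSection, ← h, map_mul]

end AffineChart

theorem IsCoherentSheaf.exists_chart {F : X.Modules} (h : F.IsCoherentSheaf) (x : X) :
    ∃ (c : AffineChart F) (p : Spec c.R), c.pt p = x := by
  obtain ⟨R, f, hf, M, ⟨p, hp⟩, hfin, ⟨e⟩⟩ := h x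
  exact ⟨⟨R, f, hf, M, hfin, e⟩, p, hp⟩

end Scheme.Modules

end AlgebraicGeometry

/-! ### Stalks of coherent sheaves -/

namespace AlgebraicGeometry.Scheme.Modules

variable {X : Scheme.{u}} {F : X.Modules}

namespace AffineChart

variable (c : AffineChart F)

theorem isNoetherianRing [IsLocallyNoetherian X] : IsNoetherianRing c.R :=
  isLocallyNoetherian_Spec.1 (isLocallyNoetherian_of_isOpenImmersion c.f)

/-- Depth at least `2` of a stalk of `F`, expressed in a chart: a regular sequence in the local ring
is cleared of its denominators. -/
theorem depthTwoAt (p : Spec c.R)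
    (h : 1 < localDepth (X.presheaf.stalk (c.pt p)) (F.stalkModule (c.pt p))) :
    DepthTwoAt c.M p.asIdeal := by
  obtain ⟨x, hxm, y, hym, hx, hy⟩ : ∃ x ∈ IsLocalRing.maximalIdeal (X.presheaf.stalk (c.pt p)),
      ∃ y ∈ IsLocalRing.maximalIdeal (X.presheaf.stalk (c.pt p)),
      (∀ v : Stalk F (c.pt p), x • v = 0 → v = 0) ∧
      ∀ v w : Stalk F (c.pt p), y • v = x • w → ∃ w' : Stalk F (c.pt p), v = x • w' :=
    exists_of_one_lt_localDepth h
  obtain ⟨s, hs, a, hsa⟩ := c.exists_mul_eq_ringGerm p x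
  obtain ⟨t, ht, b, htb⟩ := c.exists_mul_eq_ringGerm p y
  have hmax (z : X.presheaf.stalk (c.pt p)) (hz : z ∈ IsLocalRing.maximalIdeal _)
      (s a : c.R) (h : c.ringGerm p s * z = c.ringGerm p a) : a ∈ p.asIdeal := by
    by_contra ha
    rw [← c.isUnit_ringGerm_iff, ← h] at ha
    exact (IsLocalRing.mem_maximalIdeal _).1 hz (isUnit_of_mul_isUnit_right ha)
  have hsu := (c.isUnit_ringGerm_iff p s).2 hs
  have htu := (c.isUnit_ringGerm_iff p t).2 ht
  refine ⟨a, hmax x (hxm) s a hsa, b, hmax y (hym) t b htb, ?_, ?_⟩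
  · intro m u hu hm
    rw [← secGerm_eq_zero_iff]
    have := (c.secGerm_eq_zero_iff p (a • m)).2 ⟨u, hu, hm⟩
    rw [secGerm_smul, ← hsa, mul_smul] at this
    exact hx _ (hsu.smul_eq_zero.1 this)
  · intro m m' hm
    have h1 : c.ringGerm p b • c.secGerm p m = c.ringGerm p a • c.secGerm p m' := by
      rw [← secGerm_smul, hm, secGerm_smul]
    obtain ⟨t', ht'⟩ := htu.exists_left_inv
    obtain ⟨w, hw⟩ := hy (c.secGerm p m) ((t' * c.ringGerm p s) • c.secGerm p m') (by
      have h2 := congr_arg (fun v => t' • v) h1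
      simp only [smul_smul, ← htb, ← hsa] at h2
      rw [← mul_assoc, ht', one_mul] at h2
      rw [h2, smul_smul]
      congr 1
      ring)
    obtain ⟨r, hr, m'', hm''⟩ := c.exists_smul_eq_secGerm p w
    have h3 : c.secGerm p ((s * r) • m - a • m'') = 0 := by
      rw [map_sub, secGerm_smul, secGerm_smul, ← hm'', hw, map_mul, ← hsa, smul_smul, smul_smul,
        sub_eq_zero]
      congr 1
      ring
    obtain ⟨v, hv, h4⟩ := (c.secGerm_eq_zero_iff p _).1 h3
    refine ⟨v * (s * r), ?_, v • m'', ?_⟩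
    · simp only [p.isPrime.mul_mem_iff_mem_or_mem]
      tauto
    · rw [smul_sub, sub_eq_zero] at h4
      rw [mul_smul, h4, smul_comm]

theorem pt_mem_supp_iff (p : Spec c.R) : c.pt p ∈ F.supp ↔ ∃ m, c.secGerm p m ≠ 0 := by
  rw [mem_supp]
  constructor
  · rintro _
    obtain ⟨v, hv⟩ := exists_ne (0 : Stalk F (c.pt p))
    obtain ⟨s, hs, m, hm⟩ := c.exists_smul_eq_secGerm p v
    refine ⟨m, fun h => hv ?_⟩
    rwa [h, ((c.isUnit_ringGerm_iff p s).2 hs).smul_eq_zero] at hm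
  · rintro ⟨m, hm⟩
    exact ⟨_, _, hm⟩

/-- The stalk at a point of a chart is generated by the germs of sections coming from the module. -/
theorem eq_zero_of_secGerm {N : Type*} [AddCommGroup N] (p : Spec c.R)
    [Module (X.presheaf.stalk (c.pt p)) N]
    (φ : Stalk F (c.pt p) →ₗ[X.presheaf.stalk (c.pt p)] N)
    (h : ∀ m, φ (c.secGerm p m) = 0) : φ = 0 := by
  ext v
  obtain ⟨s, hs, m, hm⟩ := c.exists_smul_eq_secGerm p v
  have h1 := h m
  rw [← hm, _root_.map_smul, ((c.isUnit_ringGerm_iff p s).2 hs).smul_eq_zero] at h1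
  exact h1

end AffineChart

theorem stalkMap_id (x : X) : stalkMap (𝟙 F) x = LinearMap.id := by
  ext v
  obtain ⟨U, hU, s, rfl⟩ := F.exists_germ_eq x v
  rw [stalkMap_germ]
  rfl

theorem stalkMap_comp {G H : X.Modules} (φ : F ⟶ G) (ψ : G ⟶ H) (x : X) :
    stalkMap (φ ≫ ψ) x = stalkMap ψ x ∘ₗ stalkMap φ x := by
  ext v
  obtain ⟨U, hU, s, rfl⟩ := F.exists_germ_eq x v
  rw [LinearMap.comp_apply, stalkMap_germ, stalkMap_germ, stalkMap_germ]
  rfl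

theorem stalkMap_sub {G : X.Modules} (φ ψ : F ⟶ G) (x : X) :
    stalkMap (φ - ψ) x = stalkMap φ x - stalkMap ψ x := by
  ext v
  obtain ⟨U, hU, s, rfl⟩ := F.exists_germ_eq x v
  rw [LinearMap.sub_apply, stalkMap_germ, stalkMap_germ, stalkMap_germ, ← map_sub]
  rfl

theorem stalkMap_zero {G : X.Modules} (x : X) : stalkMap (0 : F ⟶ G) x = 0 := by
  have := stalkMap_sub (𝟙 F ≫ (0 : F ⟶ G)) 0 x
  simpa using this

theorem mem_supp_iff (x : X) : x ∈ F.supp ↔ stalkMap (𝟙 F) x ≠ 0 := by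
  rw [mem_supp, stalkMap_id, ← not_iff_not, not_not, not_nontrivial_iff_subsingleton]
  exact ⟨fun _ => LinearMap.ext fun v => Subsingleton.elim _ _,
    fun h => subsingleton_of_forall_eq 0 fun v => congr($h v)⟩

/-- The support of the image of a coherent sheaf is closed: a morphism that vanishes on the stalk at
`x` kills finitely many generators, hence vanishes near `x`. -/
theorem isClosed_setOf_stalkMap_ne_zero (hF : F.IsCoherentSheaf) {G : X.Modules} (φ : F ⟶ G) :
    IsClosed {x | stalkMap φ x ≠ 0} := by
  rw [← isOpen_compl_iff, isOpen_iff_forall_mem_open]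
  intro x hx
  obtain ⟨c, p, rfl⟩ := hF.exists_chart x
  have hx' : stalkMap φ (c.pt p) = 0 := not_not.1 hx
  have hloc (m : c.M) : ∃ V : X.Opens, ∃ (_ : c.pt p ∈ V), ∀ q : Spec c.R, c.pt q ∈ V →
      stalkMap φ (c.pt q) (c.secGerm q m) = 0 := by
    obtain ⟨V, hV, i, j, hij⟩ := G.exists_res_eq_of_germ_eq (c.pt p) (c.pt_mem p) (c.pt_mem p)
      (φ.app c.W (c.sec m)) 0 (by
        rw [← stalkMap_germ, hx', map_zero]; rfl)
    refine ⟨V, hV, fun q hq => ?_⟩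
    have := (stalkMap_germ φ (c.pt q) (c.pt_mem q) (c.sec m)).trans (G.germ_res i _ hq _).symm
    rw [hij, map_zero, map_zero] at this
    exact this
  choose V hV hVφ using hloc
  obtain ⟨s, hs⟩ := (Module.finite_def (R := c.R) (M := c.M)).1 inferInstance
  refine ⟨(c.W : Set X) ∩ ⋂ m ∈ s, (V m : Set X), ?_, ?_, c.pt_mem p,
    Set.mem_iInter₂.2 fun m _ => hV m⟩
  · rintro y ⟨hyW, hy⟩
    obtain ⟨q, rfl⟩ := c.exists_pt_eq hyW
    refine not_not.2 (c.eq_zero_of_secGerm q _ fun m => ?_)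
    have hm : m ∈ Submodule.span c.R (s : Set c.M) := hs ▸ trivial
    induction hm using Submodule.span_induction with
    | mem m hm => exact hVφ m q (Set.mem_iInter₂.1 hy m hm)
    | zero => rw [map_zero, map_zero]
    | add m m' _ _ h h' => rw [map_add, map_add, h, h', add_zero]
    | smul r m _ h => rw [c.secGerm_smul, _root_.map_smul, h, smul_zero]
  · exact c.W.isOpen.inter (isOpen_biInter_finset fun m _ => (V m).isOpen)

theorem isClosed_supp (hF : F.IsCoherentSheaf) : IsClosed F.supp := by
  have h : F.supp = {x | stalkMap (𝟙 F) x ≠ 0} := Set.ext mem_supp_iff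
  rw [h]
  exact isClosed_setOf_stalkMap_ne_zero hF _

end AlgebraicGeometry.Scheme.Modules

/-! ### Codimension in the support and depth -/

namespace AlgebraicGeometry.Scheme.Modules

variable {X : Scheme.{u}} {F : X.Modules}

/-- The prime of the local ring at `z` corresponding to a generization `y` of `z`: the preimage of
the maximal ideal of the local ring at `y`. -/
noncomputable def generizationPrime {y z : X} (h : y ⤳ z) : PrimeSpectrum (X.presheaf.stalk z) :=
  PrimeSpectrum.comap (X.presheaf.stalkSpecializes h).hom
    (IsLocalRing.closedPoint (X.presheaf.stalk y))

theorem mem_generizationPrime_iff {y z : X} (h : y ⤳ z) (r : X.presheaf.stalk z) :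
    r ∈ (generizationPrime h).asIdeal ↔ ¬ IsUnit (X.presheaf.stalkSpecializes h r) :=
  IsLocalRing.mem_maximalIdeal _

theorem fromSpecStalk_generizationPrime {y z : X} (h : y ⤳ z) :
    X.fromSpecStalk z (generizationPrime h) = y := by
  have h1 := fromSpecStalk_closedPoint (X := X) (x := y)
  rw [← SpecMap_stalkSpecializes_fromSpecStalk h] at h1
  exact h1

theorem generizationPrime_le {y y' z : X} (h : y ⤳ z) (h' : y' ⤳ y) :
    generizationPrime (h'.trans h) ≤ generizationPrime h := by
  intro r hr
  rw [mem_generizationPrime_iff] at hr ⊢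
  refine fun hu => hr ?_
  have := hu.map (X.presheaf.stalkSpecializes h').hom
  have h2 := congr($(X.presheaf.stalkSpecializes_comp h' h) r)
  exact h2 ▸ this

theorem generizationPrime_mem_support (hF : F.IsCoherentSheaf) {y z : X} (h : y ⤳ z)
    (hy : y ∈ F.supp) :
    generizationPrime h ∈ Module.support (X.presheaf.stalk z) (F.stalkModule z) := by
  obtain ⟨c, p, rfl⟩ := hF.exists_chart z
  obtain ⟨q, rfl⟩ := c.exists_pt_eq (h.mem_open c.W.isOpen (c.pt_mem p))
  obtain ⟨m, hm⟩ := (c.pt_mem_supp_iff q).1 hy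
  refine Module.mem_support_iff'.2 ⟨c.secGerm p m, fun r hr h0 => hm ?_⟩
  rw [mem_generizationPrime_iff, not_not] at hr
  obtain ⟨U, hU, a, rfl⟩ := X.presheaf.exists_germ_eq r
  obtain ⟨N, hN, hNq⟩ := F.exists_nhds_germ_smul_eq (t := (0 : Γ(F, c.W))) (c.pt p) hU (c.pt_mem p)
    (c.pt_mem p) a (c.sec m) (h0.trans (map_zero _).symm)
  have h1 := hNq (c.pt q) (h.mem_open N.isOpen hN) (h.mem_open U.isOpen hU) (c.pt_mem q)
    (c.pt_mem q)
  rw [map_zero] at h1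
  refine (IsUnit.smul_eq_zero ?_).1 h1
  rwa [TopCat.Presheaf.germ_stalkSpecializes_apply] at hr

/-- The codimension in `F.supp` of an irreducible closed subset through `z` is at most the dimension
of the stalk at `z`: generic points of larger irreducible closed subsets are generizations of `z`,
and yield primes in the support of the stalk. -/
theorem coheight_closure_le_supportDim (hF : F.IsCoherentSheaf) (z : F.supp)
    (W : IrreducibleCloseds F.supp) (hW : z ∈ W) :
    (Order.coheight W : WithBot ℕ∞) ≤
      Module.supportDim (X.presheaf.stalk (z : X)) (F.stalkModule z) := by
  have : QuasiSober F.supp := (isClosed_supp hF).isClosedEmbedding_subtypeVal.quasiSober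
  have hgen (V : IrreducibleCloseds F.supp) (x : F.supp) (hx : x ∈ V) :
      V.isIrreducible.genericPoint ⤳ x :=
    (V.isIrreducible.isGenericPoint_genericPoint V.isClosed).specializes hx
  have hgen' (V V' : IrreducibleCloseds F.supp) (h : V ≤ V') :
      (V'.isIrreducible.genericPoint : X) ⤳ V.isIrreducible.genericPoint :=
    (hgen V' _ (h (V.isIrreducible.isGenericPoint_genericPoint V.isClosed).mem)).map
      continuous_subtype_val
  have hz (V : Set.Ici W) : (V.1.isIrreducible.genericPoint : X) ⤳ z :=
    (hgen V.1 z (V.2 hW)).map continuous_subtype_val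
  rw [Order.coheight_eq_krullDim_Ici, Module.supportDim, ← Order.krullDim_orderDual]
  refine Order.krullDim_le_of_strictMono
    (β := Module.support (X.presheaf.stalk (z : X)) (F.stalkModule z))
    (fun V => ⟨generizationPrime (hz (OrderDual.ofDual V)),
      generizationPrime_mem_support hF _ (OrderDual.ofDual V).1.isIrreducible.genericPoint.2⟩) ?_
  intro V V' hlt
  have hlt' : (OrderDual.ofDual V').1 < (OrderDual.ofDual V).1 := hlt
  refine lt_of_le_of_ne (generizationPrime_le (hz (OrderDual.ofDual V')) (hgen' _ _ hlt'.le))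
    fun heq => ?_
  have h1 := congr_arg (X.fromSpecStalk (z : X)) (congr_arg Subtype.val heq)
  rw [fromSpecStalk_generizationPrime, fromSpecStalk_generizationPrime] at h1
  refine hlt'.ne (IrreducibleCloseds.ext ?_)
  rw [← (OrderDual.ofDual V').1.isIrreducible.closure_genericPoint (IrreducibleCloseds.isClosed _),
    ← (OrderDual.ofDual V).1.isIrreducible.closure_genericPoint (IrreducibleCloseds.isClosed _),
    Subtype.ext h1]

/-- Under Serre's condition `S₂`, points of codimension at least `2` in the support have depth at
least `2`. -/
theorem one_lt_localDepth (hF : F.IsCoherentSheaf) (hS2 : F.SatisfiesSerre 2) (z : F.supp)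
    (hz : 1 < topCodim (closure {z})) :
    1 < localDepth (X.presheaf.stalk (z : X)) (F.stalkModule z) := by
  let W : IrreducibleCloseds F.supp :=
    ⟨closure {z}, isIrreducible_singleton.closure, isClosed_closure⟩
  have h1 : 1 < Order.coheight W :=
    hz.trans_le (iInf₂_le W (show (W : Set F.supp) ⊆ closure {z} from fun _ h => h))
  have h2 := hS2 z z.2
  have h3 : ((2 : ℕ∞) : WithBot ℕ∞) ≤
      Module.supportDim (X.presheaf.stalk (z : X)) (F.stalkModule z) :=
    le_trans (WithBot.coe_le_coe.2 (Order.add_one_le_of_lt h1))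
      (coheight_closure_le_supportDim hF z W (subset_closure rfl))
  have h4 := (le_min le_rfl h3).trans h2
  exact lt_of_lt_of_le (by norm_num) (WithBot.coe_le_coe.1 h4)

end AlgebraicGeometry.Scheme.Modules

/-! ### Idempotents and indecomposable objects -/

namespace CategoryTheory
open Idempotents

theorem Limits.eq_zero_or_eq_id_of_indecomposable {C : Type*} [Category C] [Preadditive C]
    [HasBinaryBiproducts C] [IsIdempotentComplete C] {A : C} (hA : Indecomposable A) (e : A ⟶ A)
    (he : e ≫ e = e) : e = 0 ∨ e = 𝟙 A := by
  obtain ⟨Y, i, p, hip, hpi⟩ := IsIdempotentComplete.idempotents_split A e he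
  obtain ⟨Z, j, q, hjq, hqj⟩ := IsIdempotentComplete.idempotents_split A (𝟙 A - e) (by simp [he])
  have hiq : i ≫ q = 0 := by
    have : p ≫ (i ≫ q) ≫ j = 0 := by
      rw [Category.assoc, hqj, ← Category.assoc, hpi]; simp [he]
    have h := congr_arg (fun f => i ≫ f ≫ q) this
    simpa [hjq, reassoc_of% hip] using h
  have hjp : j ≫ p = 0 := by
    have : q ≫ (j ≫ p) ≫ i = 0 := by
      rw [Category.assoc, hpi, ← Category.assoc, hqj]; simp [he]
    have h := congr_arg (fun f => j ≫ f ≫ p) this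
    simpa [hip, reassoc_of% hjq] using h
  have iso : A ≅ Y ⊞ Z :=
    { hom := biprod.lift p q
      inv := biprod.desc i j
      hom_inv_id := by simp [biprod.lift_desc, hpi, hqj]
      inv_hom_id := by
        apply biprod.hom_ext' <;> apply biprod.hom_ext <;> simp [hip, hjq, hiq, hjp] }
  rcases hA.2 Y Z iso with hY | hZ
  · left
    rw [← hpi, hY.eq_zero_of_src i, comp_zero]
  · right
    have := hqj
    rw [hZ.eq_zero_of_src j, comp_zero] at this
    exact (sub_eq_zero.1 this.symm).symm

theorem Limits.indecomposable_of_idempotent {C : Type*} [Category C] [Preadditive C]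
    [HasBinaryBiproducts C] {A : C} (hA : ¬ IsZero A)
    (h : ∀ e : A ⟶ A, e ≫ e = e → e = 0 ∨ e = 𝟙 A) : Indecomposable A := by
  refine ⟨hA, fun Y Z i => ?_⟩
  rcases h (i.hom ≫ biprod.fst ≫ biprod.inl ≫ i.inv) (by simp) with h0 | h1
  · left
    rw [IsZero.iff_id_eq_zero]
    have := congr_arg (fun f => biprod.inl ≫ i.inv ≫ f ≫ i.hom ≫ biprod.fst) h0
    simpa using this
  · right
    rw [IsZero.iff_id_eq_zero]
    have := congr_arg (fun f => biprod.inr ≫ i.inv ≫ f ≫ i.hom ≫ biprod.snd) h1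
    simpa using this.symm

end CategoryTheory

/-! ### Cutting off sections along closed subsets -/

namespace AlgebraicGeometry.Scheme.Modules

variable {X : Scheme.{u}} {F : X.Modules}

/-- A section that vanishes off a set of points of depth at least `2` is zero: otherwise an
associated prime of one of its multiples would be a point of depth `0` in that set. -/
theorem section_eq_zero_of_germ_eq_zero [IsLocallyNoetherian X] (hF : F.IsCoherentSheaf)
    {Z : Set X} (hZ : ∀ z ∈ Z, 1 < localDepth (X.presheaf.stalk z) (F.stalkModule z))
    {V : X.Opens} (t : Γ(F, V)) (ht : ∀ x (hx : x ∈ V), x ∉ Z → F.germ x hx t = 0) : t = 0 := by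
  refine F.section_ext _ _ fun x hx => ?_
  rw [map_zero]
  by_contra hne
  obtain ⟨c, p, rfl⟩ := hF.exists_chart x
  have := c.isNoetherianRing
  obtain ⟨s, hs, m, hm⟩ := c.exists_smul_eq_secGerm p (F.germ _ hx t)
  have hm0 : ∀ u, u ∉ p.asIdeal → u • m ≠ 0 := fun u hu hum => hne <| by
    rw [← ((c.isUnit_ringGerm_iff p s).2 hs).smul_eq_zero]
    exact hm.trans ((c.secGerm_eq_zero_iff p m).2 ⟨u, hu, hum⟩)
  have := p.isPrime
  obtain ⟨q', hq', a, hle, hann⟩ := exists_prime_le_eq_annihilator_smul p.asIdeal m hm0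
  let q : Spec c.R := ⟨q', hq'⟩
  have hqp : c.pt q ⤳ c.pt p :=
    ((PrimeSpectrum.le_iff_specializes (⟨q', hq'⟩ : PrimeSpectrum c.R) p).1 hle).map c.continuous_pt
  obtain ⟨N, hN, hNq⟩ := F.exists_nhds_germ_smul_eq (c.pt p) (c.pt_mem p) hx (c.pt_mem p)
    (c.res s) t hm
  have hqV := hqp.mem_open V.isOpen hx
  have h1 : c.ringGerm q s • F.germ (c.pt q) hqV t = c.secGerm q m :=
    hNq _ (hqp.mem_open N.isOpen hN) (c.pt_mem q) hqV (c.pt_mem q)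
  have hqZ : c.pt q ∈ Z := by
    by_contra hqZ
    rw [ht _ hqV hqZ, smul_zero, eq_comm, c.secGerm_eq_zero_iff] at h1
    obtain ⟨u, hu, hum⟩ := h1
    exact hu ((hann u).2 (by rw [smul_comm, hum, smul_zero]))
  exact not_posDepthAt_of_annihilator hann (c.depthTwoAt q (hZ _ hqZ)).posDepthAt

/-- The section `t` is the part of `s` supported on `D₁`, relative to a cover of the support of `F`
by `D₁` and `D₂`: it agrees with `s` off `D₂` and vanishes off `D₁`. Nothing is required on
`D₁ ∩ D₂`. -/
def IsCutoff (D₁ D₂ : Set X) {V : X.Opens} (s t : Γ(F, V)) : Prop :=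
  ∀ x (hx : x ∈ V), (x ∉ D₂ → F.germ x hx t = F.germ x hx s) ∧ (x ∉ D₁ → F.germ x hx t = 0)

namespace IsCutoff

variable {D₁ D₂ : Set X} {V : X.Opens} {s t s' t' : Γ(F, V)}

theorem add (h : IsCutoff D₁ D₂ s t) (h' : IsCutoff D₁ D₂ s' t') :
    IsCutoff D₁ D₂ (s + s') (t + t') := fun x hx =>
  ⟨fun h2 => by rw [map_add, map_add, (h x hx).1 h2, (h' x hx).1 h2],
    fun h1 => by rw [map_add, (h x hx).2 h1, (h' x hx).2 h1, add_zero]⟩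

theorem smul (h : IsCutoff D₁ D₂ s t) (r : Γ(X, V)) : IsCutoff D₁ D₂ (r • s) (r • t) :=
  fun x hx => ⟨fun h2 => by rw [germ_smul, germ_smul, (h x hx).1 h2],
    fun h1 => by rw [germ_smul, (h x hx).2 h1, smul_zero]⟩

theorem res (h : IsCutoff D₁ D₂ s t) {V' : X.Opens} (i : V' ⟶ V) :
    IsCutoff D₁ D₂ (F.presheaf.map i.op s) (F.presheaf.map i.op t) := fun x hx =>
  ⟨fun h2 => by rw [germ_res, germ_res, (h x _).1 h2], fun h1 => by rw [germ_res, (h x _).2 h1]⟩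

theorem unique [IsLocallyNoetherian X] (hF : F.IsCoherentSheaf)
    (hD : ∀ z ∈ D₁ ∩ D₂, 1 < localDepth (X.presheaf.stalk z) (F.stalkModule z))
    (h : IsCutoff D₁ D₂ s t) (h' : IsCutoff D₁ D₂ s t') : t = t' := by
  rw [← sub_eq_zero]
  refine section_eq_zero_of_germ_eq_zero hF hD _ fun x hx hxZ => ?_
  rw [map_sub]
  by_cases h1 : x ∈ D₁
  · have h2 : x ∉ D₂ := fun h2 => hxZ ⟨h1, h2⟩
    rw [(h x hx).1 h2, (h' x hx).1 h2, sub_self]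
  · rw [(h x hx).2 h1, (h' x hx).2 h1, sub_self]

/-- Local existence of cutoffs: in a chart, `s` is a multiple of an element of the module, which
`torsionBySet_sup_eq_top` splits into parts supported on `D₁` and on `D₂`. -/
theorem exists_local [IsLocallyNoetherian X] (hF : F.IsCoherentSheaf)
    (h₁ : IsClosed D₁) (h₂ : IsClosed D₂) (hcov : F.supp ⊆ D₁ ∪ D₂)
    (hD : ∀ z ∈ D₁ ∩ D₂, 1 < localDepth (X.presheaf.stalk z) (F.stalkModule z))
    (s : Γ(F, V)) (x : X) (hx : x ∈ V) :
    ∃ (V' : X.Opens) (_ : x ∈ V') (i : V' ⟶ V) (t : Γ(F, V')),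
      IsCutoff D₁ D₂ (F.presheaf.map i.op s) t := by
  obtain ⟨c, p, rfl⟩ := hF.exists_chart x
  have := c.isNoetherianRing
  obtain ⟨I₁, I₂, hI₁, hI₂, hI⟩ := exists_ideals_of_support_subset (M := c.M)
    (h₁.preimage c.continuous_pt) (h₂.preimage c.continuous_pt) (by
      intro q hq
      obtain ⟨m, hm⟩ := Module.mem_support_iff'.1 hq
      refine hcov ((c.pt_mem_supp_iff q).2 ⟨m, fun h0 => ?_⟩)
      obtain ⟨u, hu, hum⟩ := (c.secGerm_eq_zero_iff q m).1 h0
      exact hm u hu hum)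
  have htop := torsionBySet_sup_eq_top (M := c.M) I₁ I₂ hI fun q hq hq1 hq2 =>
    c.depthTwoAt ⟨q, hq⟩ (hD _ ⟨hI₁.subset hq1, hI₂.subset hq2⟩)
  have hvan (I : Ideal c.R) (D : Set X) (hID : PrimeSpectrum.zeroLocus (I : Set c.R) = c.pt ⁻¹' D)
      (m : c.M) (hm : m ∈ Submodule.torsionBySet c.R c.M I) (q : Spec c.R) (hq : c.pt q ∉ D) :
      c.secGerm q m = 0 := by
    rw [c.secGerm_eq_zero_iff]
    obtain ⟨r, hrI, hrq⟩ :=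
      Set.not_subset.1 (fun h => hq (hID.subset h) : ¬ (I : Set c.R) ⊆ q.asIdeal)
    exact ⟨r, hrq, (Submodule.mem_torsionBySet_iff _ _).1 hm ⟨r, hrI⟩⟩
  obtain ⟨u, hu, m, hm⟩ := c.exists_smul_eq_secGerm p (F.germ _ hx s)
  obtain ⟨m₁, hm₁, m₂, hm₂, hmm⟩ := Submodule.mem_sup.1 (htop ▸ Submodule.mem_top : m ∈ _)
  obtain ⟨z, hz⟩ := ((c.isUnit_ringGerm_iff p u).2 hu).exists_left_inv
  obtain ⟨U, hU, r, rfl⟩ := X.presheaf.exists_germ_eq z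
  obtain ⟨N, hN, hNy⟩ := F.exists_nhds_germ_smul_eq (c.pt p) hU (c.pt_mem p) hx r (c.sec m) (by
    refine (congr_arg _ hm.symm).trans ?_
    rw [smul_smul, hz, one_smul])
  let V' : X.Opens := N ⊓ U ⊓ V ⊓ c.W
  let iU : V' ⟶ U := homOfLE fun y hy => hy.1.1.2
  let iV : V' ⟶ V := homOfLE fun y hy => hy.1.2
  let iW : V' ⟶ c.W := homOfLE fun y hy => hy.2
  refine ⟨V', ⟨⟨⟨hN, hU⟩, hx⟩, c.pt_mem p⟩, iV,
    X.presheaf.map iU.op r • F.presheaf.map iW.op (c.sec m₁), fun y hy => ?_⟩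
  obtain ⟨q, rfl⟩ := c.exists_pt_eq hy.2
  have hgr : X.presheaf.germ V' (c.pt q) hy (X.presheaf.map iU.op r) =
      X.presheaf.germ U (c.pt q) hy.1.1.2 r := TopCat.Presheaf.germ_res_apply X.presheaf iU _ _ r
  rw [germ_smul, germ_res, germ_res, hgr]
  change (_ → _ • c.secGerm q m₁ = _) ∧ (_ → _ • c.secGerm q m₁ = _)
  constructor
  · intro h2
    rw [← hNy _ hy.1.1.1 hy.1.1.2 hy.2 hy.1.2]
    change _ = _ • c.secGerm q m
    rw [← hmm, map_add, hvan I₂ D₂ hI₂ m₂ hm₂ q h2, add_zero]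
  · intro h1
    rw [hvan I₁ D₁ hI₁ m₁ hm₁ q h1, smul_zero]

theorem exists_global [IsLocallyNoetherian X] (hF : F.IsCoherentSheaf)
    (h₁ : IsClosed D₁) (h₂ : IsClosed D₂) (hcov : F.supp ⊆ D₁ ∪ D₂)
    (hD : ∀ z ∈ D₁ ∩ D₂, 1 < localDepth (X.presheaf.stalk z) (F.stalkModule z))
    (s : Γ(F, V)) : ∃ t : Γ(F, V), IsCutoff D₁ D₂ s t := by
  choose V' hV' i t ht using fun x : V => exists_local hF h₁ h₂ hcov hD s x.1 x.2
  obtain ⟨g, hg, -⟩ := TopCat.Sheaf.existsUnique_gluing' ⟨F.presheaf, F.isSheaf⟩ V' V i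
    (fun x hx => Opens.mem_iSup.2 ⟨⟨x, hx⟩, hV' ⟨x, hx⟩⟩) t (fun x y => by
      refine unique (s := F.presheaf.map ((Opens.infLELeft (V' x) (V' y)) ≫ i x).op s) hF hD ?_ ?_
      · have := (ht x).res (Opens.infLELeft (V' x) (V' y))
        rwa [← ConcreteCategory.comp_apply, ← Functor.map_comp, ← op_comp] at this
      · have := (ht y).res (Opens.infLERight (V' x) (V' y))
        rwa [← ConcreteCategory.comp_apply, ← Functor.map_comp, ← op_comp] at this)
  refine ⟨g, fun x hx => ?_⟩
  have h := ht ⟨x, hx⟩ x (hV' ⟨x, hx⟩)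
  have hg' : F.presheaf.map (i ⟨x, hx⟩).op g = t ⟨x, hx⟩ := hg ⟨x, hx⟩
  rwa [← hg', germ_res, germ_res] at h

end IsCutoff

/-- Cutting off along `D₁` is an idempotent endomorphism of `F`; by uniqueness of cutoffs it is
linear and compatible with restriction. -/
theorem exists_idempotent_cutoff [IsLocallyNoetherian X] (hF : F.IsCoherentSheaf) {D₁ D₂ : Set X}
    (h₁ : IsClosed D₁) (h₂ : IsClosed D₂) (hcov : F.supp ⊆ D₁ ∪ D₂)
    (hD : ∀ z ∈ D₁ ∩ D₂, 1 < localDepth (X.presheaf.stalk z) (F.stalkModule z)) :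
    ∃ e : F ⟶ F, e ≫ e = e ∧ ∀ (V : X.Opens) (s : Γ(F, V)), IsCutoff D₁ D₂ s (e.app V s) := by
  choose e he using fun (V : X.Opens) (s : Γ(F, V)) =>
    IsCutoff.exists_global hF h₁ h₂ hcov hD s
  let l (V : X.Opensᵒᵖ) : F.val.obj V →ₗ[X.ringCatSheaf.obj.obj V] F.val.obj V :=
    { toFun := e V.unop
      map_add' := fun s s' => (he _ _).unique hF hD ((he _ s).add (he _ s'))
      map_smul' := fun r s => (he _ _).unique hF hD ((he _ s).smul r) }
  refine ⟨⟨{ app := fun V => ModuleCat.ofHom (l V), naturality := fun {V V'} i => ?_ }⟩, ?_, he⟩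
  · ext s
    exact (he _ _).unique hF hD ((he _ s).res i.unop)
  · ext V s
    -- `e s` is its own cutoff.
    exact (he V (e V s)).unique hF hD fun x hx => ⟨fun _ => rfl, (he V s x hx).2⟩

end AlgebraicGeometry.Scheme.Modules

/-! ### Connectedness in codimension one -/

theorem topCodim_anti {T : Type*} [TopologicalSpace T] {Z Z' : Set T} (h : Z ⊆ Z') :
    topCodim Z' ≤ topCodim Z :=
  le_iInf₂ fun W hW => iInf₂_le W (hW.trans h)

/-- In a quasi-sober space the codimension of a set is controlled by that of its points. -/
theorem lt_topCodim_of_forall_mem {T : Type*} [TopologicalSpace T] [QuasiSober T] {Z : Set T}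
    {k : ℕ} (h : ∀ z ∈ Z, (k : ℕ∞) < topCodim (closure {z})) : (k : ℕ∞) < topCodim Z := by
  refine (ENat.add_one_le_iff (ENat.natCast_ne_top k)).1 (le_iInf₂ fun W hW => ?_)
  have hgen := W.isIrreducible.isGenericPoint_genericPoint W.isClosed
  refine (ENat.add_one_le_iff (ENat.natCast_ne_top k)).2 ((h _ (hW hgen.mem)).trans_le ?_)
  exact iInf₂_le W hgen.def.ge

namespace AlgebraicGeometry.Scheme.Modules

variable {X : Scheme.{u}} {F : X.Modules}

theorem germ_eq_zero_of_notMem_supp {V : X.Opens} (t : Γ(F, V)) {x : X} (hx : x ∈ V)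
    (h : x ∉ F.supp) : F.germ x hx t = 0 := by
  rw [mem_supp, not_nontrivial_iff_subsingleton] at h
  exact Subsingleton.elim _ _

/-- A disconnection of `F.supp ∖ Z` would make the cutoff endomorphism a nontrivial idempotent. -/
theorem connectedInCodim_one_of_indecomposable [IsLocallyNoetherian X] (hF : F.IsCoherentSheaf)
    (hS2 : F.SatisfiesSerre 2) (hind : Indecomposable F) : ConnectedInCodim 1 F.supp := by
  intro Z hZc hZ
  have hdepth (z : F.supp) (hz : z ∈ Z) :
      1 < localDepth (X.presheaf.stalk (z : X)) (F.stalkModule z) :=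
    one_lt_localDepth hF hS2 z <|
      hZ.trans_le (topCodim_anti (hZc.closure_subset_iff.2 (Set.singleton_subset_iff.2 hz)))
  constructor
  · by_contra hempty
    rw [Set.not_nonempty_iff_eq_empty, Set.compl_empty_iff] at hempty
    refine hind.1 ((IsZero.iff_id_eq_zero F).2 ?_)
    ext V s
    exact section_eq_zero_of_germ_eq_zero hF (Z := F.supp)
      (fun z hz => hdepth ⟨z, hz⟩ (hempty ▸ trivial)) _
      fun x hx hxs => germ_eq_zero_of_notMem_supp _ hx hxs
  · rw [isPreconnected_closed_iff]
    intro C₁ C₂ h₁ h₂ hcov ⟨y₁, hy₁Z, hy₁⟩ ⟨y₂, hy₂Z, hy₂⟩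
    by_contra hdisj
    have hmem (z : F.supp) (hz₁ : z ∈ C₁ ∪ Z) (hz₂ : z ∈ C₂ ∪ Z) : z ∈ Z := by
      by_contra hzZ
      exact hdisj ⟨z, hzZ, hz₁.resolve_right hzZ, hz₂.resolve_right hzZ⟩
    have hcl := (isClosed_supp hF).isClosedEmbedding_subtypeVal.isClosedMap
    obtain ⟨e, hidem, he⟩ := exists_idempotent_cutoff hF
      (hcl _ (h₁.union hZc)) (hcl _ (h₂.union hZc))
      (fun x hx => by
        by_cases hxZ : (⟨x, hx⟩ : F.supp) ∈ Z
        · exact Or.inl ⟨⟨x, hx⟩, Or.inr hxZ, rfl⟩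
        · exact (hcov hxZ).imp (fun h => ⟨⟨x, hx⟩, Or.inl h, rfl⟩)
            fun h => ⟨⟨x, hx⟩, Or.inl h, rfl⟩)
      (by
        rintro _ ⟨⟨z, hz₁, rfl⟩, ⟨z', hz₂, hzz'⟩⟩
        obtain rfl := Subtype.ext hzz'
        exact hdepth z' (hmem z' hz₁ hz₂))
    have hnot (C : Set F.supp) (z : F.supp) (hz : z ∉ C) :
        (z : X) ∉ (Subtype.val '' C : Set X) := by
      rintro ⟨z', hz', h⟩
      exact hz (Subtype.ext h ▸ hz')
    -- The idempotent is the identity at `y₁` and zero at `y₂`, hence neither `0` nor `𝟙 F`.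
    have hy₁' : (y₁ : X) ∉ (Subtype.val '' (C₂ ∪ Z) : Set X) :=
      hnot _ _ fun h => hy₁Z (hmem y₁ (Or.inl hy₁) h)
    have hy₂' : (y₂ : X) ∉ (Subtype.val '' (C₁ ∪ Z) : Set X) :=
      hnot _ _ fun h => hy₂Z (hmem y₂ h (Or.inl hy₂))
    have he₁ : stalkMap e (y₁ : X) = LinearMap.id := by
      ext v
      obtain ⟨V, hV, s, rfl⟩ := F.exists_germ_eq _ v
      rw [stalkMap_germ]
      exact (he V s _ hV).1 hy₁'
    have he₂ : stalkMap e (y₂ : X) = 0 := by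
      ext v
      obtain ⟨V, hV, s, rfl⟩ := F.exists_germ_eq _ v
      rw [stalkMap_germ]
      exact (he V s _ hV).2 hy₂'
    rcases eq_zero_or_eq_id_of_indecomposable hind e hidem with h0 | h1
    · refine (mem_supp_iff (F := F) y₁).1 y₁.2 ?_
      rw [stalkMap_id, ← he₁, h0, stalkMap_zero]
    · exact (mem_supp_iff (F := F) y₂).1 y₂.2 (h1 ▸ he₂)

/-- For an idempotent `e`, the supports of `e` and `𝟙 F - e` are closed and meet in codimension at
least `2`; by connectedness one of them is contained in the other, hence consists of points of depth
at least `2`, and the corresponding endomorphism vanishes. -/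
theorem indecomposable_of_connectedInCodim_one [IsLocallyNoetherian X] (hF : F.IsCoherentSheaf)
    (hS2 : F.SatisfiesSerre 2) (hne : ¬ IsZero F)
    (hstalk : ∀ x : F.supp, topCodim (closure ({x} : Set F.supp)) ≤ 1 →
      Indecomposable (F.stalkModule (x : X)))
    (hconn : ConnectedInCodim 1 F.supp) : Indecomposable F := by
  refine indecomposable_of_idempotent hne fun e he => ?_
  have hsober : QuasiSober F.supp := (isClosed_supp hF).isClosedEmbedding_subtypeVal.quasiSober
  have hidem (x : X) : stalkMap e x ∘ₗ stalkMap e x = stalkMap e x := by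
    rw [← stalkMap_comp, he]
  let D₁ : Set F.supp := {x | stalkMap e (x : X) ≠ 0}
  let D₂ : Set F.supp := {x | stalkMap (𝟙 F - e) (x : X) ≠ 0}
  have h₁ : IsClosed D₁ := (isClosed_setOf_stalkMap_ne_zero hF e).preimage continuous_subtype_val
  have h₂ : IsClosed D₂ :=
    (isClosed_setOf_stalkMap_ne_zero hF (𝟙 F - e)).preimage continuous_subtype_val
  -- At a point of codimension at most `1` the stalk is indecomposable, so `e` is `0` or `1` there.
  have hcodim (z : F.supp) (hz : z ∈ D₁ ∩ D₂) : 1 < topCodim (closure {z}) := by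
    by_contra hle
    rcases eq_zero_or_eq_id_of_indecomposable (hstalk z (not_lt.1 hle))
      (ModuleCat.ofHom (stalkMap e (z : X))) (ModuleCat.hom_ext (hidem z)) with h | h
    · exact hz.1 congr($(h).hom)
    · refine hz.2 ?_
      rw [stalkMap_sub, stalkMap_id, sub_eq_zero]
      exact congr($(h).hom).symm
  have hvanish (φ : F ⟶ F) (hφ : ∀ z : F.supp, stalkMap φ (z : X) ≠ 0 → z ∈ D₁ ∩ D₂) : φ = 0 := by
    ext V s
    refine section_eq_zero_of_germ_eq_zero hF (Z := {x | stalkMap φ x ≠ 0} ∩ F.supp)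
      (fun z hz => one_lt_localDepth hF hS2 ⟨z, hz.2⟩ (hcodim _ (hφ ⟨z, hz.2⟩ hz.1))) _
      fun x hx hxZ => ?_
    by_cases hxs : x ∈ F.supp
    · have h0 : stalkMap φ x = 0 := by
        by_contra h0
        exact hxZ ⟨h0, hxs⟩
      rw [← stalkMap_germ, h0, LinearMap.zero_apply]
    · exact germ_eq_zero_of_notMem_supp _ hx hxs
  have hcov (z : F.supp) : z ∈ D₁ ∪ D₂ := by
    by_contra hz
    simp only [Set.mem_union, not_or, D₁, D₂, Set.mem_ofPred_eq, not_not] at hz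
    refine (mem_supp_iff (z : X)).1 z.2 ?_
    rw [← sub_add_cancel (stalkMap (𝟙 F) (z : X)) (stalkMap e (z : X)), ← stalkMap_sub, hz.1, hz.2,
      add_zero]
  have hpre := (hconn (D₁ ∩ D₂) (h₁.inter h₂)
    (lt_topCodim_of_forall_mem (k := 1) hcodim)).isPreconnected
  rw [isPreconnected_closed_iff] at hpre
  by_cases hn₁ : ((D₁ ∩ D₂)ᶜ ∩ D₁).Nonempty
  · by_cases hn₂ : ((D₁ ∩ D₂)ᶜ ∩ D₂).Nonempty
    · obtain ⟨z, hz, hz'⟩ := hpre D₁ D₂ h₁ h₂ (fun z _ => hcov z) hn₁ hn₂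
      exact absurd hz' hz
    · right
      refine (sub_eq_zero.1 (hvanish (𝟙 F - e) fun z hz => ?_)).symm
      by_contra hzZ
      exact hn₂ ⟨z, hzZ, hz⟩
  · left
    refine hvanish e fun z hz => ?_
    by_contra hzZ
    exact hn₁ ⟨z, hzZ, hz⟩

end AlgebraicGeometry.Scheme.Modules

theorem theorem3p2 {X : Scheme.{u}} [AlgebraicGeometry.IsNoetherian X] (F : X.Modules)
    (hcoh : F.IsCoherentSheaf) (hF : ¬ IsZero F) (hS2 : F.SatisfiesSerre 2) :
    (Indecomposable F → ConnectedInCodim 1 F.supp) ∧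
    ((∀ x : F.supp, topCodim (closure ({x} : Set F.supp)) ≤ 1 →
        Indecomposable (F.stalkModule (x : X))) →
      (Indecomposable F ↔ ConnectedInCodim 1 F.supp)) :=
  ⟨Scheme.Modules.connectedInCodim_one_of_indecomposable hcoh hS2, fun hstalk =>
    ⟨Scheme.Modules.connectedInCodim_one_of_indecomposable hcoh hS2,
      Scheme.Modules.indecomposable_of_connectedInCodim_one hcoh hS2 hF hstalk⟩⟩
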